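/- Let $\alpha>-1/2$. Let $G_k^{(\alpha)}$ be the Gegenbauer polynomial of degree $k$ with parameter $\alpha$, normalized by $G_k^{(\alpha)}(1)=1$, and for $l>0$ let $G_{l,k}^{(\alpha)}(x)=G_k^{(\alpha)}(2x/l-1)$ be the shifted Gegenbauer polynomial on $[0,l]$. For $n\ge 0$ let $x_0<\dots<x_n$ be the zeros of $G_{l,n+1}^{(\alpha)}$ and let $L_0,\dots,L_n$ be the Lagrange interpolating polynomials at these nodes. For $0\le i\le n$ the first-order (barycentric) shifted Gegenbauer quadrature approximates $\int_0^{x_i}f(x)\,dx$ by $\sum_{j=0}^n f(x_j)\int_0^{x_i}L_j(x)\,dx$, and its truncation error is $$E_{1,l,n}^{(\alpha)}=\int_0^{x_i}f(x)\,dx-\sum_{j=0}^n f(x_j)\int_0^{x_i}L_j(x)\,dx .$$ Suppose that $f\in C^{n+1}[0,l]$ and $\sup_{0\le x\le l}|f^{(n+1)}(x)|\le A$, where $A>0$. Then the following hold for all $i=0,\dots,n$. 1. If $\alpha\ge 0$ and $n\ge 0$, then $$|E_{1,l,n}^{(\alpha)}|\le \frac{A\,2^{-2n-1}\,\Gamma(\alpha+1)\,x_i\,l^{n+1}\,\Gamma(n+2\alpha+1)}{\Gamma(2\alpha+1)\,\Gamma(n+2)\,\Gamma(n+\alpha+1)}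 .$$ If $-1/2<\alpha<0$ and $n$ is odd, then $$|E_{1,l,n}^{(\alpha)}|\le \frac{A\,2^{-2n-1}\,\Gamma(\alpha+1)\,x_i\,l^{n+1}\,\Gamma(n+2\alpha+1)}{\Gamma(2\alpha+1)\,\Gamma(n+2)\,\Gamma(n+\alpha+1)}\cdot\frac{(n+1)!\,|\Gamma(2\alpha)|}{\Gamma(n+2\alpha+1)}\left|\binom{\frac{n+1}{2}+\alpha-1}{\frac{n+1}{2}}\right| .$$ If $-1/2<\alpha<0$ and $n\ge0$ is even, then $$|E_{1,l,n}^{(\alpha)}|< \frac{A\,2^{-2n-1}\,|\Gamma(\alpha)|\,|\alpha|\,x_i\,l^{n+1}}{\sqrt{(n+1)(2\alpha+n+1)}\;\Gamma(n+\alpha+1)}\left|\binom{\frac n2+\alpha}{\frac n2}\right| .$$ 2. There are positive constants $D_1^{(\alpha)},D_2^{(\alpha)}$ and an integer $N$, depending only on $\alpha$, such that, with $B_1^{(\alpha)}=A\,D_1^{(\alpha)}$ and $B_2^{(\alpha)}=B_1^{(\alpha)}D_2^{(\alpha)}$, for all $n\ge N$, $$|E_{1,l,n}^{(\alpha)}|\le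 B_1^{(\alpha)}\frac{e^n\,l^{n+1}\,x_i}{2^{2n+1}\,n^{n+3/2-\alpha}}\quad\text{if }\alpha\ge 0,\qquad |E_{1,l,n}^{(\alpha)}|\le B_2^{(\alpha)}\frac{e^n\,l^{n+1}\,x_i}{2^{2n+1}\,n^{n+3/2}}\quad\text{if }-\tfrac12<\alpha<0 .$$ 3. In particular the error decays exponentially: for every $l>0$ there are $c>0$ and $\rho\in(0,1)$, depending only on $\alpha$ and $l$, such that $|E_{1,l,n}^{(\alpha)}|\le A\,c\,\rho^n$ for all $n\ge0$ and all $f$ and $A$ as above. Here $\binom{z}{k}=z(z-1)\cdots(z-k+1)/k!$ for real $z$ and integers $k\ge0$. -/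

import Mathlib

open Polynomial

noncomputable section

/-- The Gegenbauer polynomials with parameter `α > -1/2`, in the standardization with value `1`
at the point `1` (so that `α = 0` gives the Chebyshev polynomials of the first kind and `α = 1/2`
the Legendre polynomials), by their three-term recurrence
`(j + 2α) G_{j+1}(x) = 2 (j + α) x G_j(x) - j G_{j-1}(x)` for `j ≥ 1`. -/
def gegenbauer (α : ℝ) : ℕ → ℝ[X]
  | 0 => 1
  | 1 => X
  | j + 2 =>
      C (((j : ℝ) + 1 + 2 * α)⁻¹) *
        (C (2 * ((j : ℝ) + 1 + α)) * X * gegenbauer α (j + 1) - C ((j : ℝ) + 1) * gegenbauer α j)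

/-- The shifted Gegenbauer polynomial on `[0, l]`, namely `x ↦ G_k (2 x / l - 1)`. -/
def shiftedGegenbauer (l α : ℝ) (k : ℕ) : ℝ[X] :=
  (gegenbauer α k).comp (C (2 / l) * X - 1)

/-- The zeros of the shifted Gegenbauer polynomial of degree `n + 1`, in increasing order. -/
def sggNodeList (l α : ℝ) (n : ℕ) : List ℝ :=
  (shiftedGegenbauer l α (n + 1)).roots.toFinset.sort (· ≤ ·)

/-- The shifted Gegenbauer-Gauss node `x_i`, for `i = 0, …, n`: the `i`-th zero, in increasing
order, of the shifted Gegenbauer polynomial of degree `n + 1`. -/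
def sggNode (l α : ℝ) (n : ℕ) (i : Fin (n + 1)) : ℝ :=
  (sggNodeList l α n).getD i 0

/-- The first-order shifted Gegenbauer integration matrix: the entry `(i, j)` is the integral over
`[0, x_i]` of the `j`-th Lagrange polynomial for the shifted Gegenbauer-Gauss nodes. (The
barycentric formula is a way to evaluate this same polynomial.) -/
def bsgim (l α : ℝ) (n : ℕ) (i j : Fin (n + 1)) : ℝ :=
  ∫ x in (0 : ℝ)..sggNode l α n i, (Lagrange.basis Finset.univ (sggNode l α n) j).eval x

/-- The barycentric shifted Gegenbauer quadrature for the integral of `f` over `[0, x_i]`. -/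
def bsgq (l α : ℝ) (n : ℕ) (f : ℝ → ℝ) (i : Fin (n + 1)) : ℝ :=
  ∑ j, bsgim l α n i j * f (sggNode l α n j)

/-- The truncation error of the quadrature at the node `x_i`. -/
def bsgqError (l α : ℝ) (n : ℕ) (f : ℝ → ℝ) (i : Fin (n + 1)) : ℝ :=
  (∫ x in (0 : ℝ)..sggNode l α n i, f x) - bsgq l α n f i

/-- `f` is of class `C^{n+1}` on `[0, l]`, and its derivative of order `n + 1` (one-sided at the
end points) is bounded by `A` there. -/
def DerivBound (l : ℝ) (n : ℕ) (f : ℝ → ℝ) (A : ℝ) : Prop :=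
  ContDiffOn ℝ (n + 1 : ℕ) f (Set.Icc 0 l) ∧
    ∀ x ∈ Set.Icc 0 l, |iteratedDerivWithin (n + 1) f (Set.Icc 0 l) x| ≤ A

end

/-!
The nodes are the zeros of the shifted Gegenbauer polynomial of degree `n + 1`, so their nodal
polynomial is that polynomial divided by its leading coefficient. Integrating the error formula
`f - P = f⁽ⁿ⁺¹⁾(ξ) / (n + 1)! * ∏ⱼ (x - xⱼ)` of the interpolating polynomial `P` of `f` therefore
reduces everything to the supremum of `|G|` on `[-1, 1]`, where `G` has degree `n + 1` and
parameter `α`.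

Write `N = (n + 1) (n + 1 + 2α)`. By the differential equation
`(1 - x²) G'' - (2α + 1) x G' + N G = 0`, the derivative of Sonine's function
`N G² + (1 - x²) G'²` is `4 α x G'²`. Hence this function is largest at `±1` if `α ≥ 0`, which gives
`|G| ≤ 1`, and at `0` if `α ≤ 0`; there its value is `N G(0)²` for odd `n` and `G'(0)²` for even
`n`, both quotients of Gamma values by the three-term recurrence. Euler's limit formula
for `Γ` and Stirling's lower bound for the factorial then give the asymptotic estimates.
-/

open Set Filter Topology Real
open scoped Finset Nat

section Nodal

variable {R ι : Type*} [CommRing R] {s : Finset ι} {v : ι → R}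

theorem coeff_card_nodal [Nontrivial R] : (Lagrange.nodal s v).coeff #s = 1 := by
  simpa only [Monic, leadingCoeff, Lagrange.natDegree_nodal] using
    (Lagrange.nodal_monic : (Lagrange.nodal s v).Monic)

theorem eq_C_coeff_mul_nodal [IsDomain R] {p : R[X]} (hp : p.natDegree ≤ #s) (hv : InjOn v s)
    (hzero : ∀ i ∈ s, p.eval (v i) = 0) : p = C (p.coeff #s) * Lagrange.nodal s v := by
  refine eq_of_degree_sub_lt_of_eval_index_eq s hv
    ((degree_lt_iff_coeff_zero _ _).2 fun m hm => ?_) fun i hi => ?_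
  · rcases hm.eq_or_lt with rfl | hm
    · rw [coeff_sub, coeff_C_mul, coeff_card_nodal, mul_one, sub_self]
    · rw [coeff_sub, coeff_C_mul, coeff_eq_zero_of_natDegree_lt (hp.trans_lt hm),
        coeff_eq_zero_of_natDegree_lt (Lagrange.natDegree_nodal.trans_lt hm), mul_zero, sub_zero]
  · rw [hzero i hi, eval_mul, Lagrange.eval_nodal_at_node hi, mul_zero]

end Nodal

section Interpolation

variable {a b : ℝ} {f : ℝ → ℝ}

theorem exists_finset_deriv_eq_zero {m : ℕ} {t : Finset ℝ} (ht : #t = m + 1)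
    (hsub : ↑t ⊆ Icc a b) (hf : ContinuousOn f (Icc a b)) (hzero : ∀ x ∈ t, f x = 0) :
    ∃ s : Finset ℝ, #s = m ∧ ∀ x ∈ s, x ∈ Ioo a b ∧ deriv f x = 0 := by
  set e : Fin (m + 1) ↪o ℝ := t.orderEmbOfFin ht
  have he (i) : e i ∈ t := t.orderEmbOfFin_mem ht i
  have hrolle (i : Fin m) : ∃ x ∈ Ioo (e i.castSucc) (e i.succ), deriv f x = 0 :=
    exists_deriv_eq_zero (e.strictMono i.castSucc_lt_succ)
      (hf.mono (Icc_subset_Icc (hsub (he _)).1 (hsub (he _)).2))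
      ((hzero _ (he _)).trans (hzero _ (he _)).symm)
  choose z hz hz' using hrolle
  have hmono : StrictMono z := fun i j hij => calc
    z i < e i.succ := (hz i).2
    _ ≤ e j.castSucc := e.monotone (Fin.succ_le_castSucc_iff.2 hij)
    _ < z j := (hz j).1
  refine ⟨Finset.univ.map ⟨z, hmono.injective⟩, by simp, ?_⟩
  simp only [Finset.mem_map, Finset.mem_univ, true_and, Function.Embedding.coeFn_mk,
    forall_exists_index, forall_apply_eq_imp_iff]
  exact fun i => ⟨⟨(hsub (he _)).1.trans_lt (hz i).1, (hz i).2.trans_le (hsub (he _)).2⟩, hz' i⟩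

theorem exists_iteratedDerivWithin_eq_zero (hab : a < b) {m : ℕ} (hf : ContDiffOn ℝ m f (Icc a b))
    {t : Finset ℝ} (ht : #t = m + 1) (hsub : ↑t ⊆ Icc a b) (hzero : ∀ x ∈ t, f x = 0) :
    ∃ ξ ∈ Icc a b, iteratedDerivWithin m f (Icc a b) ξ = 0 := by
  induction m generalizing f t with
  | zero =>
    obtain ⟨x, rfl⟩ := Finset.card_eq_one.1 ht
    exact ⟨x, hsub (by simp), by simpa using hzero x⟩
  | succ m ih =>
    obtain ⟨s, hs, hs'⟩ := exists_finset_deriv_eq_zero ht hsub hf.continuousOn hzero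
    obtain ⟨ξ, hξ, hderiv⟩ := ih (hf.derivWithin (uniqueDiffOn_Icc hab) (by simp)) hs
      (fun x hx => Ioo_subset_Icc_self (hs' x hx).1) fun x hx => by
        rw [derivWithin_of_mem_nhds (Icc_mem_nhds_iff.2 (hs' x hx).1), (hs' x hx).2]
    exact ⟨ξ, hξ, by rw [iteratedDerivWithin_succ', hderiv]⟩

theorem iteratedDerivWithin_eval_of_natDegree_le {𝕜 : Type*} [NontriviallyNormedField 𝕜]
    {s : Set 𝕜} (hs : UniqueDiffOn 𝕜 s) {m : ℕ} {p : 𝕜[X]} (hp : p.natDegree ≤ m) {x : 𝕜}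
    (hx : x ∈ s) :
    iteratedDerivWithin m (fun y => p.eval y) s x = m ! * p.coeff m := by
  induction m generalizing p with
  | zero => rw [eq_C_of_natDegree_le_zero hp]; simp
  | succ m ih =>
    have hderiv : s.EqOn (derivWithin (fun y => p.eval y) s) fun y => (derivative p).eval y :=
      fun y hy => p.derivWithin (hs y hy)
    rw [iteratedDerivWithin_succ', iteratedDerivWithin_congr hderiv hx,
      ih (p.natDegree_derivative_le.trans (by lia)), coeff_derivative, Nat.factorial_succ]
    push_cast
    ring

theorem exists_iteratedDerivWithin_eq_factorial_mul_coeff (hab : a < b) {m : ℕ}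
    (hf : ContDiffOn ℝ m f (Icc a b)) {p : ℝ[X]} (hp : p.natDegree ≤ m) {t : Finset ℝ}
    (ht : #t = m + 1) (hsub : ↑t ⊆ Icc a b) (heq : ∀ y ∈ t, f y = p.eval y) :
    ∃ ξ ∈ Icc a b, iteratedDerivWithin m f (Icc a b) ξ = m ! * p.coeff m := by
  have hpoly : ContDiff ℝ m fun y => p.eval y := p.contDiff_aeval m
  obtain ⟨ξ, hξ, hderiv⟩ := exists_iteratedDerivWithin_eq_zero hab (hf.sub hpoly.contDiffOn)
    ht hsub fun y hy => sub_eq_zero.2 (heq y hy)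
  refine ⟨ξ, hξ, ?_⟩
  rw [← iteratedDerivWithin_eval_of_natDegree_le (uniqueDiffOn_Icc hab) hp hξ, ← sub_eq_zero,
    ← iteratedDerivWithin_sub hξ (uniqueDiffOn_Icc hab) (hf ξ hξ) hpoly.contDiffWithinAt]
  exact hderiv

variable {ι : Type*} [DecidableEq ι] {s : Finset ι} {v : ι → ℝ}

theorem exists_sub_interpolate_eq (hab : a < b) (hf : ContDiffOn ℝ #s f (Icc a b))
    (hv : InjOn v s) (hmem : ∀ i ∈ s, v i ∈ Icc a b) {x : ℝ} (hx : x ∈ Icc a b) :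
    ∃ ξ ∈ Icc a b, f x - (Lagrange.interpolate s v (f ∘ v)).eval x =
      iteratedDerivWithin #s f (Icc a b) ξ / (#s)! * (Lagrange.nodal s v).eval x := by
  set P := Lagrange.interpolate s v (f ∘ v)
  set W := Lagrange.nodal s v
  have hP (i) (hi : i ∈ s) : P.eval (v i) = f (v i) := Lagrange.eval_interpolate_at_node _ hv hi
  have hW (i) (hi : i ∈ s) : W.eval (v i) = 0 := Lagrange.eval_nodal_at_node hi
  by_cases hnode : ∃ i ∈ s, v i = x
  · obtain ⟨i, hi, rfl⟩ := hnode
    exact ⟨v i, hx, by rw [hP i hi, hW i hi, sub_self, mul_zero]⟩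
  push Not at hnode
  have hWx : W.eval x ≠ 0 := Lagrange.eval_nodal_not_at_node fun i hi => (hnode i hi).symm
  -- With this `c`, the polynomial `P + c W` interpolates `f` at `x` as well.
  set c := (f x - P.eval x) / W.eval x
  have hc : c * W.eval x = f x - P.eval x := div_mul_cancel₀ _ hWx
  have hPdeg : P.degree < #s := Lagrange.degree_interpolate_lt _ hv
  have hdeg : (P + C c * W).natDegree ≤ #s := natDegree_add_le_of_degree_le
    (natDegree_le_of_degree_le hPdeg.le)
    ((natDegree_C_mul_le _ _).trans Lagrange.natDegree_nodal.le)
  have hcoeff : (P + C c * W).coeff #s = c := by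
    rw [coeff_add, coeff_C_mul, coeff_card_nodal, coeff_eq_zero_of_degree_lt hPdeg]
    ring
  obtain ⟨ξ, hξ, hderiv⟩ := exists_iteratedDerivWithin_eq_factorial_mul_coeff hab hf hdeg
    (t := insert x (s.image v))
    (by rw [Finset.card_insert_of_notMem (by simpa using hnode), Finset.card_image_of_injOn hv])
    (by simpa [Set.insert_subset_iff, Set.subset_def, hx.1, hx.2] using hmem)
    (by simpa +contextual [hP, hW] using eq_add_of_sub_eq' hc.symm)
  exact ⟨ξ, hξ, by rw [hderiv, hcoeff, mul_div_cancel_left₀ _ (by positivity), hc]⟩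

theorem abs_integral_sub_integral_interpolate_le (hab : a < b) (hf : ContDiffOn ℝ #s f (Icc a b))
    (hv : InjOn v s) (hmem : ∀ i ∈ s, v i ∈ Icc a b) {A : ℝ}
    (hA : ∀ x ∈ Icc a b, |iteratedDerivWithin #s f (Icc a b) x| ≤ A) {c : ℝ} (hc : c ∈ Icc a b) :
    |(∫ x in a..c, f x) - ∫ x in a..c, (Lagrange.interpolate s v (f ∘ v)).eval x| ≤
      A / (#s)! * ∫ x in a..c, |(Lagrange.nodal s v).eval x| := by
  have hsub : Icc a c ⊆ Icc a b := Icc_subset_Icc_right hc.2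
  have hfi : IntervalIntegrable f MeasureTheory.volume a c :=
    ContinuousOn.intervalIntegrable_of_Icc hc.1 (hf.continuousOn.mono hsub)
  have hbound : IntervalIntegrable (fun x => A / (#s)! * |(Lagrange.nodal s v).eval x|)
      MeasureTheory.volume a c := Continuous.intervalIntegrable (by fun_prop) _ _
  rw [← intervalIntegral.integral_sub hfi (Continuous.intervalIntegrable (by fun_prop) _ _),
    ← intervalIntegral.integral_const_mul, ← Real.norm_eq_abs]
  refine intervalIntegral.norm_integral_le_of_norm_le hc.1 (.of_forall fun x hx => ?_) hbound
  obtain ⟨ξ, hξ, herror⟩ :=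
    exists_sub_interpolate_eq hab hf hv hmem (hsub (Ioc_subset_Icc_self hx))
  rw [herror, norm_mul, Real.norm_eq_abs, abs_div, Nat.abs_cast, Real.norm_eq_abs]
  gcongr
  exact hA ξ hξ

end Interpolation

section Gegenbauer

variable {α : ℝ}

theorem gegenbauer_add_two (hα : -1 / 2 < α) (n : ℕ) :
    C ((n : ℝ) + 1 + 2 * α) * gegenbauer α (n + 2) =
      C (2 * ((n : ℝ) + 1 + α)) * X * gegenbauer α (n + 1) - C ((n : ℝ) + 1) * gegenbauer α n := by
  have hne : (n : ℝ) + 1 + 2 * α ≠ 0 := by linarith [n.cast_nonneg (α := ℝ)]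
  rw [gegenbauer, ← mul_assoc, ← C_mul, mul_inv_cancel₀ hne, C_1, one_mul]

theorem eval_gegenbauer_add_two (hα : -1 / 2 < α) (n : ℕ) (x : ℝ) :
    ((n : ℝ) + 1 + 2 * α) * (gegenbauer α (n + 2)).eval x =
      2 * ((n : ℝ) + 1 + α) * x * (gegenbauer α (n + 1)).eval x
        - ((n : ℝ) + 1) * (gegenbauer α n).eval x := by
  simpa using congrArg (eval x) (gegenbauer_add_two hα n)

theorem eval_one_gegenbauer (hα : -1 / 2 < α) (n : ℕ) : (gegenbauer α n).eval 1 = 1 := by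
  induction n using Nat.twoStepInduction with
  | zero => simp [gegenbauer]
  | one => simp [gegenbauer]
  | more n ih₀ ih₁ =>
    have hne : (n : ℝ) + 1 + 2 * α ≠ 0 := by linarith [n.cast_nonneg (α := ℝ)]
    refine mul_left_cancel₀ hne ?_
    rw [eval_gegenbauer_add_two hα, ih₀, ih₁]
    ring

theorem eval_neg_gegenbauer (α : ℝ) (n : ℕ) (x : ℝ) :
    (gegenbauer α n).eval (-x) = (-1) ^ n * (gegenbauer α n).eval x := by
  induction n using Nat.twoStepInduction with
  | zero => simp [gegenbauer]
  | one => simp [gegenbauer]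
  | more n ih₀ ih₁ =>
    simp only [gegenbauer, eval_mul, eval_sub, eval_C, eval_X, ih₀, ih₁]
    ring

theorem eval_zero_gegenbauer_of_odd {n : ℕ} (hn : Odd n) : (gegenbauer α n).eval 0 = 0 := by
  have h := eval_neg_gegenbauer α n 0
  rw [neg_zero, hn.neg_one_pow] at h
  linarith

theorem gegenbauer_derivative_relations (hα : -1 / 2 < α) (n : ℕ) :
    C ((n : ℝ) + 2 * α) * (X * derivative (gegenbauer α (n + 1))
        - C ((n : ℝ) + 1) * gegenbauer α (n + 1)) = C ((n : ℝ) + 1) * derivative (gegenbauer α n) ∧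
    C ((n : ℝ) + 2 * α) * derivative (gegenbauer α (n + 1)) =
      C ((n : ℝ) + 1) * (X * derivative (gegenbauer α n) + C ((n : ℝ) + 2 * α) * gegenbauer α n) ∧
    (1 - X ^ 2) * derivative (gegenbauer α (n + 1)) =
      C ((n : ℝ) + 1) * (gegenbauer α n - X * gegenbauer α (n + 1)) := by
  induction n with
  | zero =>
    simp only [CharP.cast_eq_zero, zero_add, map_mul, gegenbauer, derivative_X, mul_one, map_one,
      one_mul, sub_self, mul_zero, derivative_one, sub_right_inj, true_and]
    ring
  | succ n ih =>
    obtain ⟨h₁, h₂, h₃⟩ := ih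
    have hne : (C ((n : ℝ) + 1 + 2 * α) : ℝ[X]) ≠ 0 :=
      C_ne_zero.2 (by linarith [n.cast_nonneg (α := ℝ)])
    have hrec := gegenbauer_add_two hα n
    have hrec' := congrArg derivative hrec
    simp only [derivative_mul, derivative_sub, derivative_C, derivative_X, zero_mul, zero_add,
      mul_one] at hrec'
    simp only [Nat.cast_add, Nat.cast_one, map_add, map_mul, C_1, map_ofNat] at *
    have h₂' : (C (n : ℝ) + 1 + 2 * C α) * derivative (gegenbauer α (n + 1 + 1)) =
        (C (n : ℝ) + 1 + 1) * (X * derivative (gegenbauer α (n + 1))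
          + (C (n : ℝ) + 1 + 2 * C α) * gegenbauer α (n + 1)) := by
      linear_combination hrec' + h₁
    have h₁' : (C (n : ℝ) + 1 + 2 * C α) * (X * derivative (gegenbauer α (n + 1 + 1))
        - (C (n : ℝ) + 1 + 1) * gegenbauer α (n + 1 + 1)) =
        (C (n : ℝ) + 1 + 1) * derivative (gegenbauer α (n + 1)) := by
      linear_combination X * h₂' - (C (n : ℝ) + 1 + 1) * hrec - (C (n : ℝ) + 1 + 1) * h₃
    exact ⟨h₁', h₂', mul_left_cancel₀ hne (by linear_combination h₂' - X * h₁')⟩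

theorem derivative_derivative_gegenbauer (hα : -1 / 2 < α) (n : ℕ) :
    (1 - X ^ 2) * derivative (derivative (gegenbauer α n)) =
      C (2 * α + 1) * X * derivative (gegenbauer α n)
        - C (n * (n + 2 * α)) * gegenbauer α n := by
  cases n with
  | zero => simp [gegenbauer]
  | succ n =>
    obtain ⟨h₁, -, h₃⟩ := gegenbauer_derivative_relations hα n
    have h₃' := congrArg derivative h₃
    simp only [derivative_mul, derivative_sub, derivative_C, derivative_X, derivative_one,
      derivative_X_pow, Nat.cast_add, Nat.cast_one, Nat.cast_ofNat, map_add, map_mul, map_ofNat,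
      C_1] at h₁ h₃' ⊢
    linear_combination h₃' - h₁

theorem eval_zero_derivative_gegenbauer (hα : -1 / 2 < α) (n : ℕ) :
    (derivative (gegenbauer α (n + 1))).eval 0 = ((n : ℝ) + 1) * (gegenbauer α n).eval 0 := by
  simpa using congrArg (eval 0) (gegenbauer_derivative_relations hα n).2.2

theorem eval_derivative_gegenbauer_eq_add_one (hα : -1 / 2 < α) (n : ℕ) (x : ℝ) :
    (2 * α + 1) * (derivative (gegenbauer α (n + 1))).eval x =
      ((n : ℝ) + 1) * (n + 1 + 2 * α) * (gegenbauer (α + 1) n).eval x := by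
  have hrel (k : ℕ) := gegenbauer_derivative_relations hα k
  have h₁ (k : ℕ) := congrArg (eval x) (hrel k).1
  have h₂ (k : ℕ) := congrArg (eval x) (hrel k).2.1
  simp only [eval_mul, eval_sub, eval_add, eval_C, eval_X] at h₁ h₂
  induction n using Nat.twoStepInduction with
  | zero =>
    simp only [gegenbauer, derivative_X, eval_one, mul_one, CharP.cast_eq_zero, zero_add, one_mul]
    ring
  | one =>
    have h := h₂ 1
    simp only [Nat.cast_one, gegenbauer, CharP.cast_eq_zero, zero_add, map_mul, map_add, map_one,
      mul_one, derivative_mul, derivative_C, zero_mul, derivative_sub,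
      derivative_one, add_zero, mul_zero, derivative_X, sub_zero, eval_mul, eval_C, eval_add,
      eval_one, eval_X] at h ⊢
    linear_combination h
  | more n ih₀ ih₁ =>
    have := n.cast_nonneg (α := ℝ)
    have hrec := eval_gegenbauer_add_two (α := α + 1) (by linarith) n x
    have h₁ := h₁ (n + 1)
    have h₂ := h₂ (n + 2)
    push_cast at h₁ h₂ ih₁ ⊢
    have ha : (n : ℝ) + 1 + 2 * α ≠ 0 := by linarith
    have hb : (n : ℝ) + 2 + 2 * α ≠ 0 := by linarith
    have hc : (n : ℝ) + 2 ≠ 0 := by positivity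
    refine mul_left_cancel₀ (mul_ne_zero (mul_ne_zero ha hb) hc) ?_
    linear_combination (2 * α + 1) * (n + 1 + 2 * α) * (n + 2) * h₂
      - (2 * α + 1) * (n + 3) * (n + 2 + 2 * α) * h₁
      + 2 * (n + 3) * (n + 1 + 2 * α) * (n + 2 + α) * x * ih₁
      - (n + 3) * (n + 2) * (n + 2 + 2 * α) * ih₀
      - (n + 3) * (n + 2) * (n + 1 + 2 * α) * (n + 2 + 2 * α) * hrec

theorem natDegree_gegenbauer_le (α : ℝ) (n : ℕ) : (gegenbauer α n).natDegree ≤ n := by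
  induction n using Nat.twoStepInduction with
  | zero => simp [gegenbauer]
  | one => simp [gegenbauer]
  | more n ih₀ ih₁ =>
    rw [gegenbauer]
    compute_degree
    exact max_le (by lia) (by lia)

theorem coeff_gegenbauer (hα : -1 / 2 < α) (n : ℕ) :
    (gegenbauer α (n + 1)).coeff (n + 1) =
      2 ^ n * Gamma (n + α + 1) * Gamma (2 * α + 1)
        / (Gamma (n + 2 * α + 1) * Gamma (α + 1)) := by
  have hΓ : Gamma (α + 1) ≠ 0 := (Gamma_pos_of_pos (by linarith)).ne'
  have hΓ' : Gamma (2 * α + 1) ≠ 0 := (Gamma_pos_of_pos (by linarith)).ne'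
  induction n with
  | zero => simp [gegenbauer, mul_comm (Gamma (α + 1)), hΓ, hΓ']
  | succ n ih =>
    have := n.cast_nonneg (α := ℝ)
    have hne : (n : ℝ) + 1 + 2 * α ≠ 0 := by linarith
    have hΓn : Gamma (n + 2 * α + 1) ≠ 0 := (Gamma_pos_of_pos (by linarith)).ne'
    have hcoeff := congrArg (coeff · (n + 2)) (gegenbauer_add_two hα n)
    simp only [coeff_sub, coeff_C_mul, mul_assoc, coeff_X_mul, ih,
      coeff_eq_zero_of_natDegree_lt ((natDegree_gegenbauer_le α n).trans_lt (by lia : n < n + 2)),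
      mul_zero, sub_zero] at hcoeff
    refine mul_left_cancel₀ hne (hcoeff.trans ?_)
    push_cast
    have hne' : (n : ℝ) + 2 * α + 1 ≠ 0 := by linarith
    rw [show (n : ℝ) + 1 + α + 1 = n + α + 1 + 1 by ring,
      Gamma_add_one (s := n + α + 1) (by linarith),
      show (n : ℝ) + 1 + 2 * α + 1 = n + 2 * α + 1 + 1 by ring,
      Gamma_add_one (s := n + 2 * α + 1) hne']
    field_simp
    ring

theorem hasDerivAt_weight_mul_derivative_gegenbauer (hα : -1 / 2 < α) (n : ℕ) {x : ℝ}
    (hx : x ∈ Ioo (-1) 1) :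
    HasDerivAt (fun y => (1 - y ^ 2) ^ (α + 1 / 2) * (derivative (gegenbauer α n)).eval y)
      (-(n * (n + 2 * α)) * (1 - x ^ 2) ^ (α - 1 / 2) * (gegenbauer α n).eval x) x := by
  have hpos : 0 < 1 - x ^ 2 := by nlinarith [hx.1, hx.2]
  have hbase : HasDerivAt (fun y : ℝ => 1 - y ^ 2) (-(2 * x)) x := by
    simpa using (hasDerivAt_pow 2 x).const_sub 1
  have hode := congrArg (eval x) (derivative_derivative_gegenbauer hα n)
  simp only [eval_mul, eval_sub, eval_C, eval_X, eval_one, eval_pow] at hode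
  refine ((hbase.rpow_const (.inl hpos.ne')).mul
    ((derivative (gegenbauer α n)).hasDerivAt x)).congr_deriv ?_
  rw [show α + 1 / 2 - 1 = α - 1 / 2 by ring, show α + 1 / 2 = α - 1 / 2 + 1 by ring,
    rpow_add_one hpos.ne']
  linear_combination (1 - x ^ 2) ^ (α - 1 / 2) * hode

/-- Rolle's theorem applied to `(1 - x²) ^ (α + 1/2) G'`, which vanishes at `±1` and at the zeros of
the derivative, a multiple of the Gegenbauer polynomial with parameter `α + 1`. -/
theorem exists_finset_eval_gegenbauer_eq_zero (hα : -1 / 2 < α) (n : ℕ) :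
    ∃ z : Finset ℝ, #z = n ∧ ∀ x ∈ z, x ∈ Ioo (-1) 1 ∧ (gegenbauer α n).eval x = 0 := by
  induction n generalizing α with
  | zero => exact ⟨∅, by simp⟩
  | succ n ih =>
    have := n.cast_nonneg (α := ℝ)
    obtain ⟨z, hcard, hz⟩ := ih (α := α + 1) (by linarith)
    set f : ℝ → ℝ := fun y =>
      (1 - y ^ 2) ^ (α + 1 / 2) * (derivative (gegenbauer α (n + 1))).eval y
    have hf : Continuous f := (Continuous.rpow_const (by fun_prop) fun _ => .inr (by linarith)).mul
      (by fun_prop)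
    have hderiv (x) (hx : x ∈ z) : (derivative (gegenbauer α (n + 1))).eval x = 0 := by
      have h := eval_derivative_gegenbauer_eq_add_one hα n x
      rw [(hz x hx).2, mul_zero] at h
      exact (mul_eq_zero.1 h).resolve_left (by linarith)
    have hcard' : #(insert (-1) (insert 1 z)) = n + 1 + 1 := by
      rw [Finset.card_insert_of_notMem, Finset.card_insert_of_notMem, hcard]
      · exact fun h => lt_irrefl _ (hz 1 h).1.2
      · rw [Finset.mem_insert, not_or]
        exact ⟨by norm_num, fun h => lt_irrefl _ (hz (-1) h).1.1⟩
    have hexp : α + 2⁻¹ ≠ 0 := by linarith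
    obtain ⟨s, hs, hs'⟩ := exists_finset_deriv_eq_zero hcard' (a := -1) (b := 1)
      (by simpa [Set.insert_subset_iff, Set.subset_def] using
        fun x hx => ⟨(hz x hx).1.1.le, (hz x hx).1.2.le⟩) hf.continuousOn
      (by simp +contextual [f, hderiv, zero_rpow hexp])
    refine ⟨s, hs, fun x hx => ⟨(hs' x hx).1, ?_⟩⟩
    obtain ⟨hxI, hx0⟩ := hs' x hx
    have hpos : 0 < 1 - x ^ 2 := by nlinarith [hxI.1, hxI.2]
    rw [(hasDerivAt_weight_mul_derivative_gegenbauer hα (n + 1) hxI).deriv] at hx0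
    refine (mul_eq_zero.1 hx0).resolve_left
      (mul_ne_zero (neg_ne_zero.2 ?_) (rpow_pos_of_pos hpos _).ne')
    push_cast
    exact mul_ne_zero (by positivity) (by linarith)

theorem gegenbauer_ne_zero (hα : -1 / 2 < α) (n : ℕ) : gegenbauer α n ≠ 0 := by
  intro h
  simpa [h] using eval_one_gegenbauer hα n

theorem card_roots_toFinset_gegenbauer_and_subset_Ioo (hα : -1 / 2 < α) (n : ℕ) :
    #(gegenbauer α n).roots.toFinset = n ∧ ↑(gegenbauer α n).roots.toFinset ⊆ Ioo (-1 : ℝ) 1 := by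
  obtain ⟨z, hcard, hz⟩ := exists_finset_eval_gegenbauer_eq_zero hα n
  have hroots : z = (gegenbauer α n).roots.toFinset := by
    refine Finset.eq_of_subset_of_card_le (fun x hx => ?_) ?_
    · exact Multiset.mem_toFinset.2 ((mem_roots (gegenbauer_ne_zero hα n)).2 (hz x hx).2)
    · rw [hcard]
      exact (Multiset.toFinset_card_le _).trans
        ((card_roots' _).trans (natDegree_gegenbauer_le α n))
  exact ⟨hroots ▸ hcard, fun x hx => (hz x (hroots ▸ hx)).1⟩

end Gegenbauer

section Nodes

variable {l α : ℝ}

theorem roots_shiftedGegenbauer (hl : l ≠ 0) (α : ℝ) (n : ℕ) :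
    (shiftedGegenbauer l α n).roots = (gegenbauer α n).roots.map fun z => l / 2 * (z + 1) := by
  have hunit : IsUnit (2 / l) := (div_ne_zero two_ne_zero hl).isUnit
  have hlin : (C (2 / l) * X - 1 : ℝ[X]) = C (2 / l) * X + C (-1) := by
    rw [C_neg, C_1, sub_eq_add_neg]
  rw [shiftedGegenbauer, hlin, roots_comp_C_mul_X_add_C _ _ _ hunit]
  simp only [Ring.inverse_eq_inv', inv_div, sub_neg_eq_add]

theorem card_roots_toFinset_shiftedGegenbauer (hα : -1 / 2 < α) (hl : l ≠ 0) (n : ℕ) :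
    #(shiftedGegenbauer l α n).roots.toFinset = n := by
  have hinj : Function.Injective fun z => l / 2 * (z + 1) :=
    (mul_right_injective₀ (by positivity)).comp (add_left_injective 1)
  rw [roots_shiftedGegenbauer hl, Multiset.toFinset_map, Finset.card_image_of_injective _ hinj,
    (card_roots_toFinset_gegenbauer_and_subset_Ioo hα n).1]

theorem sggNode_eq_orderEmbOfFin (hα : -1 / 2 < α) (hl : l ≠ 0) (n : ℕ) :
    sggNode l α n =
      Finset.orderEmbOfFin _ (card_roots_toFinset_shiftedGegenbauer hα hl (n + 1)) := by
  ext i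
  rw [Finset.orderEmbOfFin_apply, sggNode]
  exact List.getD_eq_getElem _ _ _

theorem sggNode_injective (hα : -1 / 2 < α) (hl : l ≠ 0) (n : ℕ) :
    Function.Injective (sggNode l α n) := by
  rw [sggNode_eq_orderEmbOfFin hα hl]
  exact (Finset.orderEmbOfFin _ _).injective

theorem two_div_mul_sggNode_sub_one_mem (hα : -1 / 2 < α) (hl : l ≠ 0) (n : ℕ) (i : Fin (n + 1)) :
    2 / l * sggNode l α n i - 1 ∈ (gegenbauer α (n + 1)).roots.toFinset := by
  have hmem : sggNode l α n i ∈ (shiftedGegenbauer l α (n + 1)).roots.toFinset := by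
    rw [sggNode_eq_orderEmbOfFin hα hl]
    exact Finset.orderEmbOfFin_mem _ _ _
  rw [roots_shiftedGegenbauer hl, Multiset.toFinset_map, Finset.mem_image] at hmem
  obtain ⟨z, hz, hnode⟩ := hmem
  rwa [← hnode, show 2 / l * (l / 2 * (z + 1)) - 1 = z by field_simp; ring]

theorem eval_gegenbauer_sggNode (hα : -1 / 2 < α) (hl : l ≠ 0) (n : ℕ) (i : Fin (n + 1)) :
    (gegenbauer α (n + 1)).eval (2 / l * sggNode l α n i - 1) = 0 :=
  (mem_roots'.1 (Multiset.mem_toFinset.1 (two_div_mul_sggNode_sub_one_mem hα hl n i))).2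

theorem sggNode_mem_Ioo (hα : -1 / 2 < α) (hl : 0 < l) (n : ℕ) (i : Fin (n + 1)) :
    sggNode l α n i ∈ Ioo 0 l := by
  have hmem := (card_roots_toFinset_gegenbauer_and_subset_Ioo hα (n + 1)).2
    (two_div_mul_sggNode_sub_one_mem hα hl.ne' n i)
  have hnode : sggNode l α n i = l / 2 * (2 / l * sggNode l α n i - 1 + 1) := by field_simp; ring
  constructor <;> rw [hnode] <;> nlinarith [hmem.1, hmem.2]

theorem coeff_mul_eval_nodal_sggNode (hα : -1 / 2 < α) (hl : l ≠ 0) (n : ℕ) (x : ℝ) :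
    (gegenbauer α (n + 1)).coeff (n + 1) * (2 / l) ^ (n + 1) *
        (Lagrange.nodal Finset.univ (sggNode l α n)).eval x =
      (gegenbauer α (n + 1)).eval (2 / l * x - 1) := by
  have hinj : Function.Injective fun i => 2 / l * sggNode l α n i - 1 :=
    ((sub_left_injective (b := (1 : ℝ))).comp
      (mul_right_injective₀ (div_ne_zero two_ne_zero hl))).comp (sggNode_injective hα hl n)
  have hcard : #(Finset.univ : Finset (Fin (n + 1))) = n + 1 := Finset.card_fin _
  have hprod := congrArg (eval (2 / l * x - 1)) (eq_C_coeff_mul_nodal (s := Finset.univ)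
    (by rw [hcard]; exact natDegree_gegenbauer_le α (n + 1)) hinj.injOn
    fun i _ => eval_gegenbauer_sggNode hα hl n i)
  rw [hprod, hcard, eval_mul, eval_C, Lagrange.eval_nodal, Lagrange.eval_nodal, mul_assoc,
    ← Fin.prod_const, ← Finset.prod_mul_distrib]
  congr 1
  exact Finset.prod_congr rfl fun i _ => by ring

end Nodes

section Error

variable {l α A : ℝ} {n : ℕ} {f : ℝ → ℝ}

theorem bsgq_eq_integral_interpolate (l α : ℝ) (n : ℕ) (f : ℝ → ℝ) (i : Fin (n + 1)) :
    bsgq l α n f i = ∫ x in (0 : ℝ)..sggNode l α n i,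
      (Lagrange.interpolate Finset.univ (sggNode l α n) (f ∘ sggNode l α n)).eval x := by
  simp only [Lagrange.interpolate_apply, eval_finsetSum, eval_mul, eval_C]
  rw [intervalIntegral.integral_finsetSum fun j _ =>
    Continuous.intervalIntegrable (by fun_prop) _ _]
  simp only [bsgq, bsgim, intervalIntegral.integral_const_mul, Function.comp_apply, mul_comm]

theorem Gamma_natCast_add_two (n : ℕ) : Gamma (n + 2) = (n + 1)! := by
  rw [← Gamma_nat_eq_factorial]
  push_cast
  ring_nf

/-- The factor of the error bounds that depends only on `α` and `n`:
`l ^ (n + 1) / 2 ^ (2 * n + 1) * errorCoeff α n` is the reciprocal of `(n + 1)!` times the leading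
coefficient of the shifted Gegenbauer polynomial of degree `n + 1` on `[0, l]`. -/
noncomputable def errorCoeff (α : ℝ) (n : ℕ) : ℝ :=
  Gamma (α + 1) * Gamma (n + 2 * α + 1) / (Gamma (2 * α + 1) * Gamma (n + 2) * Gamma (n + α + 1))

theorem errorCoeff_pos (hα : -1 / 2 < α) (n : ℕ) : 0 < errorCoeff α n := by
  have := n.cast_nonneg (α := ℝ)
  have := Gamma_pos_of_pos (s := α + 1) (by linarith)
  have := Gamma_pos_of_pos (s := 2 * α + 1) (by linarith)
  have := Gamma_pos_of_pos (s := n + 2) (by linarith)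
  have := Gamma_pos_of_pos (s := n + α + 1) (by linarith)
  have := Gamma_pos_of_pos (s := n + 2 * α + 1) (by linarith)
  unfold errorCoeff
  positivity

theorem eval_nodal_sggNode_div_factorial (hα : -1 / 2 < α) (hl : l ≠ 0) (n : ℕ) (x : ℝ) :
    (Lagrange.nodal Finset.univ (sggNode l α n)).eval x / (n + 1)! =
      l ^ (n + 1) / 2 ^ (2 * n + 1) *
        (errorCoeff α n * (gegenbauer α (n + 1)).eval (2 / l * x - 1)) := by
  have := n.cast_nonneg (α := ℝ)
  have h₁ := (Gamma_pos_of_pos (s := α + 1) (by linarith)).ne'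
  have h₂ := (Gamma_pos_of_pos (s := 2 * α + 1) (by linarith)).ne'
  have h₃ := (Gamma_pos_of_pos (s := n + α + 1) (by linarith)).ne'
  have h₄ := (Gamma_pos_of_pos (s := n + 2 * α + 1) (by linarith)).ne'
  rw [← coeff_mul_eval_nodal_sggNode hα hl, coeff_gegenbauer hα, errorCoeff, Gamma_natCast_add_two,
    div_pow]
  generalize Gamma (2 * α + 1) = a at *
  generalize Gamma (n + 2 * α + 1) = b at *
  field_simp
  ring

theorem abs_bsgqError_le_integral (hα : -1 / 2 < α) (hl : 0 < l) (hf : DerivBound l n f A)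
    (i : Fin (n + 1)) :
    |bsgqError l α n f i| ≤ A * (l ^ (n + 1) / 2 ^ (2 * n + 1)) *
      ∫ x in (0 : ℝ)..sggNode l α n i,
        errorCoeff α n * |(gegenbauer α (n + 1)).eval (2 / l * x - 1)| := by
  have hcard : #(Finset.univ : Finset (Fin (n + 1))) = n + 1 := Finset.card_fin _
  have hcoeff := errorCoeff_pos hα n
  rw [bsgqError, bsgq_eq_integral_interpolate]
  refine (abs_integral_sub_integral_interpolate_le hl (by rw [hcard]; exact hf.1)
    (sggNode_injective hα hl.ne' n).injOn
    (fun j _ => Ioo_subset_Icc_self (sggNode_mem_Ioo hα hl n j)) (by rw [hcard]; exact hf.2)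
    (Ioo_subset_Icc_self (sggNode_mem_Ioo hα hl n i))).trans_eq ?_
  rw [← intervalIntegral.integral_const_mul, ← intervalIntegral.integral_const_mul, hcard]
  refine intervalIntegral.integral_congr fun x _ => ?_
  have hnodal := congrArg abs (eval_nodal_sggNode_div_factorial hα hl.ne' n x)
  rw [abs_div, Nat.abs_cast, abs_mul, abs_mul, abs_of_pos hcoeff,
    abs_of_pos (a := l ^ (n + 1) / 2 ^ (2 * n + 1)) (by positivity)] at hnodal
  linear_combination A * hnodal

/-- The inequality is strict because the Gegenbauer polynomial vanishes at the end point `x_i` of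
the interval of integration. -/
theorem abs_bsgqError_lt (hα : -1 / 2 < α) (hl : 0 < l) (hA : 0 < A) (hf : DerivBound l n f A)
    (i : Fin (n + 1)) {B : ℝ}
    (hB : ∀ x ∈ Icc (-1 : ℝ) 1, errorCoeff α n * |(gegenbauer α (n + 1)).eval x| ≤ B) :
    |bsgqError l α n f i| < A * l ^ (n + 1) * sggNode l α n i / 2 ^ (2 * n + 1) * B := by
  obtain ⟨hpos, hlt⟩ := sggNode_mem_Ioo hα hl n i
  have hBpos : 0 < B := by
    have h := hB 1 (by norm_num)
    rw [eval_one_gegenbauer hα, abs_one, mul_one] at h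
    exact (errorCoeff_pos hα n).trans_le h
  have hint : ∫ x in (0 : ℝ)..sggNode l α n i,
      errorCoeff α n * |(gegenbauer α (n + 1)).eval (2 / l * x - 1)| <
        ∫ _ in (0 : ℝ)..sggNode l α n i, B := by
    refine intervalIntegral.integral_lt_integral_of_continuousOn_of_le_of_exists_lt hpos
      (by fun_prop) (by fun_prop) (fun x hx => hB _ ⟨?_, ?_⟩)
      ⟨sggNode l α n i, right_mem_Icc.2 hpos.le, ?_⟩
    · linarith [mul_pos (div_pos two_pos hl) hx.1]
    · have : 2 / l * x ≤ 2 / l * l := by gcongr; exact hx.2.trans hlt.le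
      rw [div_mul_cancel₀ _ hl.ne'] at this
      linarith
    · rwa [eval_gegenbauer_sggNode hα hl.ne', abs_zero, mul_zero]
  rw [intervalIntegral.integral_const, sub_zero, smul_eq_mul] at hint
  calc |bsgqError l α n f i|
    _ ≤ _ := abs_bsgqError_le_integral hα hl hf i
    _ < A * (l ^ (n + 1) / 2 ^ (2 * n + 1)) * (sggNode l α n i * B) := by gcongr
    _ = _ := by ring

end Error

section Sonine

theorem monotoneOn_Ici_and_antitoneOn_Iic_of_hasDerivAt_mul_self {f k : ℝ → ℝ}
    (hf : ∀ x, HasDerivAt f (k x * x) x) (hk : ∀ x, 0 ≤ k x) :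
    MonotoneOn f (Ici 0) ∧ AntitoneOn f (Iic 0) := by
  have hcont : Continuous f := continuous_iff_continuousAt.2 fun x => (hf x).continuousAt
  constructor
  · refine monotoneOn_of_hasDerivWithinAt_nonneg (convex_Ici 0) hcont.continuousOn
      (fun x _ => (hf x).hasDerivWithinAt) fun x hx => ?_
    rw [interior_Ici] at hx
    exact mul_nonneg (hk x) hx.le
  · refine antitoneOn_of_hasDerivWithinAt_nonpos (convex_Iic 0) hcont.continuousOn
      (fun x _ => (hf x).hasDerivWithinAt) fun x hx => ?_
    rw [interior_Iic] at hx
    exact mul_nonpos_of_nonneg_of_nonpos (hk x) hx.le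

/-- Sonine's function of the Gegenbauer polynomial `G` of degree `n`, multiplied by the constant
`n (n + 2α)` of the differential equation of `G`. On `[-1, 1]` it majorizes `n (n + 2α) G²`, and it
is monotone on both sides of `0`. -/
noncomputable def sonine (α : ℝ) (n : ℕ) : ℝ[X] :=
  C (n * (n + 2 * α)) * gegenbauer α n ^ 2 + (1 - X ^ 2) * derivative (gegenbauer α n) ^ 2

variable {α : ℝ} {n : ℕ} {x : ℝ}

theorem derivative_sonine (hα : -1 / 2 < α) (n : ℕ) :
    derivative (sonine α n) = C (4 * α) * X * derivative (gegenbauer α n) ^ 2 := by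
  have hode := derivative_derivative_gegenbauer hα n
  simp only [sonine, sq, derivative_mul, derivative_sub, derivative_C,
    derivative_one, derivative_ofNat, derivative_X, map_add, map_mul, map_ofNat, C_1] at hode ⊢
  linear_combination 2 * derivative (gegenbauer α n) * hode

theorem hasDerivAt_sonine (hα : -1 / 2 < α) (n : ℕ) (x : ℝ) :
    HasDerivAt (fun y => (sonine α n).eval y)
      (4 * α * (derivative (gegenbauer α n)).eval x ^ 2 * x) x := by
  refine ((sonine α n).hasDerivAt x).congr_deriv ?_
  simp only [derivative_sonine hα, eval_mul, eval_C, eval_X, eval_pow]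
  ring

theorem mul_sq_eval_gegenbauer_le_eval_sonine (α : ℝ) (n : ℕ) (hx : x ∈ Icc (-1) 1) :
    n * (n + 2 * α) * (gegenbauer α n).eval x ^ 2 ≤ (sonine α n).eval x := by
  have hpos : 0 ≤ 1 - x ^ 2 := by nlinarith [hx.1, hx.2]
  simp only [sonine, eval_add, eval_mul, eval_sub, eval_C, eval_X, eval_one, eval_pow]
  exact le_add_of_nonneg_right (by positivity)

theorem eval_sonine_le_of_nonneg (hα : 0 ≤ α) (n : ℕ) (hx : x ∈ Icc (-1) 1) :
    (sonine α n).eval x ≤ n * (n + 2 * α) := by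
  have hα' : -1 / 2 < α := by linarith
  obtain ⟨hmono, hanti⟩ := monotoneOn_Ici_and_antitoneOn_Iic_of_hasDerivAt_mul_self
    (hasDerivAt_sonine hα' n) fun x => by positivity
  rcases le_total 0 x with h | h
  · refine (hmono h (mem_Ici.2 zero_le_one) hx.2).trans_eq ?_
    simp [sonine, eval_one_gegenbauer hα']
  · refine (hanti (mem_Iic.2 (by norm_num)) h hx.1).trans_eq ?_
    simp [sonine, eval_neg_gegenbauer, eval_one_gegenbauer hα', ← pow_mul]

theorem eval_sonine_le_eval_zero (hα : -1 / 2 < α) (hα₀ : α ≤ 0) (n : ℕ) (x : ℝ) :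
    (sonine α n).eval x ≤ (sonine α n).eval 0 := by
  obtain ⟨hmono, hanti⟩ := monotoneOn_Ici_and_antitoneOn_Iic_of_hasDerivAt_mul_self
    (f := fun y => -(sonine α n).eval y)
    (k := fun y => -(4 * α) * (derivative (gegenbauer α n)).eval y ^ 2)
    (fun y => (hasDerivAt_sonine hα n y).neg.congr_deriv (by ring))
    fun y => mul_nonneg (by linarith) (sq_nonneg _)
  rcases le_total 0 x with h | h
  · exact neg_le_neg_iff.1 (hmono self_mem_Ici h h)
  · exact neg_le_neg_iff.1 (hanti h self_mem_Iic h)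

theorem abs_eval_gegenbauer_le_one (hα : 0 ≤ α) (n : ℕ) (hx : x ∈ Icc (-1) 1) :
    |(gegenbauer α n).eval x| ≤ 1 := by
  rcases n.eq_zero_or_pos with rfl | hn
  · simp [gegenbauer]
  have hpos : 0 < (n : ℝ) * (n + 2 * α) := by positivity
  rw [← sq_le_one_iff_abs_le_one]
  refine le_of_mul_le_mul_left ?_ hpos
  rw [mul_one]
  exact (mul_sq_eval_gegenbauer_le_eval_sonine α n hx).trans (eval_sonine_le_of_nonneg hα n hx)

theorem mul_sq_eval_gegenbauer_add_one_le (hα : -1 / 2 < α) (hα₀ : α ≤ 0) (n : ℕ)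
    (hx : x ∈ Icc (-1) 1) :
    (n + 1) * (2 * α + n + 1) * (gegenbauer α (n + 1)).eval x ^ 2 ≤
      (n + 1) * (2 * α + n + 1) * (gegenbauer α (n + 1)).eval 0 ^ 2
        + ((n + 1) * (gegenbauer α n).eval 0) ^ 2 := by
  have h := (mul_sq_eval_gegenbauer_le_eval_sonine α (n + 1) hx).trans
    (eval_sonine_le_eval_zero hα hα₀ (n + 1) x)
  simp only [sonine, eval_add, eval_mul, eval_sub, eval_C, eval_X, eval_one, eval_pow,
    eval_zero_derivative_gegenbauer hα] at h
  push_cast at h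
  linear_combination h

theorem abs_eval_gegenbauer_add_one_le_of_odd (hα : -1 / 2 < α) (hα₀ : α ≤ 0) (hn : Odd n)
    (hx : x ∈ Icc (-1) 1) :
    |(gegenbauer α (n + 1)).eval x| ≤ |(gegenbauer α (n + 1)).eval 0| := by
  have hpos : 0 < ((n : ℝ) + 1) * (2 * α + n + 1) :=
    mul_pos (by positivity) (by linarith [n.cast_nonneg (α := ℝ)])
  have h := mul_sq_eval_gegenbauer_add_one_le hα hα₀ n hx
  rw [eval_zero_gegenbauer_of_odd hn, mul_zero, zero_pow two_ne_zero, add_zero] at h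
  exact sq_le_sq.1 (le_of_mul_le_mul_left h hpos)

theorem abs_eval_gegenbauer_add_one_le_of_even (hα : -1 / 2 < α) (hα₀ : α ≤ 0) (hn : Even n)
    (hx : x ∈ Icc (-1) 1) :
    |(gegenbauer α (n + 1)).eval x| ≤
      (n + 1) * |(gegenbauer α n).eval 0| / √((n + 1) * (2 * α + n + 1)) := by
  have hpos : 0 < ((n : ℝ) + 1) * (2 * α + n + 1) :=
    mul_pos (by positivity) (by linarith [n.cast_nonneg (α := ℝ)])
  have h := mul_sq_eval_gegenbauer_add_one_le hα hα₀ n hx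
  rw [eval_zero_gegenbauer_of_odd hn.add_one, zero_pow two_ne_zero, mul_zero, zero_add] at h
  refine abs_le_of_sq_le_sq ?_ (by positivity)
  rw [div_pow, sq_sqrt hpos.le, le_div_iff₀ hpos, mul_pow, sq_abs, ← mul_pow, mul_comm]
  exact h

end Sonine

section GeneralizedBinomial

theorem add_one_mul_ring_choose_add_one (β : ℝ) (m : ℕ) :
    (m + 1) * Ring.choose (m + 1 + β) (m + 1) = (m + β + 1) * Ring.choose (m + β) m := by
  have h := Ring.choose_add_smul_choose (m + β) m 1
  rw [Nat.choose_one_right, nsmul_eq_mul, Ring.choose_one_right] at h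
  push_cast at h
  rwa [show (m : ℝ) + 1 + β = m + β + 1 by ring]

theorem add_one_mul_ring_choose (β : ℝ) (m : ℕ) :
    (m + 1) * Ring.choose (m + β) (m + 1) = β * Ring.choose (m + β) m := by
  have h := Ring.choose_smul_choose ((m : ℝ) + β) m.le_succ
  rw [Nat.choose_succ_self_right, nsmul_eq_mul, Nat.succ_eq_add_one, Nat.add_sub_cancel_left,
    Ring.choose_one_right] at h
  push_cast at h
  linear_combination h

theorem ring_choose_natCast_add {β : ℝ} (hβ : -1 < β) (m : ℕ) :
    Ring.choose (m + β) m = Gamma (m + β + 1) / (m ! * Gamma (β + 1)) := by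
  have hΓ := Gamma_pos_of_pos (s := β + 1) (by linarith)
  rw [eq_div_iff (by positivity)]
  induction m with
  | zero => simp
  | succ m ih =>
    have := m.cast_nonneg (α := ℝ)
    have h := add_one_mul_ring_choose_add_one β m
    rw [Nat.factorial_succ]
    push_cast
    rw [show (m : ℝ) + 1 + β + 1 = m + β + 1 + 1 by ring,
      Gamma_add_one (s := m + β + 1) (by linarith), ← ih]
    linear_combination m ! * Gamma (β + 1) * h

theorem ring_choose_natCast_add_pos {β : ℝ} (hβ : -1 < β) (m : ℕ) :
    0 < Ring.choose (m + β) m := by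
  have hΓ := Gamma_pos_of_pos (s := β + 1) (by linarith)
  have hΓ' := Gamma_pos_of_pos (s := m + β + 1) (by linarith [m.cast_nonneg (α := ℝ)])
  rw [ring_choose_natCast_add hβ]
  positivity

theorem factorial_mul_abs_Gamma_mul_abs_ring_choose {α : ℝ} (hα : -1 / 2 < α) (hα₀ : α ≠ 0)
    (m : ℕ) :
    (2 * m + 1 + 1)! * |Gamma (2 * α)| * |Ring.choose (m + α) (m + 1)| =
      (2 * m + 1)! * Gamma (2 * α + 1) * Ring.choose (m + α) m := by
  have hchoose := congrArg abs (add_one_mul_ring_choose α m)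
  rw [abs_mul, abs_mul, abs_of_pos (ring_choose_natCast_add_pos (by linarith) m),
    abs_of_pos (a := (m : ℝ) + 1) (by positivity)] at hchoose
  have hΓ := congrArg abs (Gamma_add_one (s := 2 * α) (by simpa))
  rw [abs_of_pos (Gamma_pos_of_pos (by linarith)), abs_mul, abs_mul, abs_two] at hΓ
  rw [hΓ, Nat.factorial_succ (2 * m + 1)]
  push_cast
  linear_combination 2 * (2 * m + 1)! * |Gamma (2 * α)| * hchoose

end GeneralizedBinomial

section ErrorCoefficient

variable {α x : ℝ} {n : ℕ}

theorem Gamma_mul_abs_eval_zero_gegenbauer (hα : -1 / 2 < α) (m : ℕ) :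
    Gamma (2 * m + 2 * α + 1) * |(gegenbauer α (2 * m)).eval 0| =
      (2 * m)! * Gamma (2 * α + 1) * Ring.choose (m + α) m := by
  induction m with
  | zero => simp [gegenbauer]
  | succ m ih =>
    have := m.cast_nonneg (α := ℝ)
    have hrec := congrArg abs (eval_gegenbauer_add_two hα (2 * m) 0)
    push_cast at hrec
    rw [mul_zero, zero_mul, zero_sub, abs_neg, abs_mul, abs_mul,
      abs_of_pos (a := 2 * (m : ℝ) + 1 + 2 * α) (by linarith),
      abs_of_pos (a := 2 * (m : ℝ) + 1) (by linarith)] at hrec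
    have hchoose := add_one_mul_ring_choose_add_one α m
    have hΓ := Gamma_add_one (s := 2 * m + 2 * α + 1) (by linarith)
    have hΓ' := Gamma_add_one (s := 2 * m + 2 * α + 1 + 1) (by linarith)
    rw [show 2 * (m + 1) = 2 * m + 2 by ring, Nat.factorial_succ, Nat.factorial_succ]
    push_cast
    rw [show 2 * ((m : ℝ) + 1) + 2 * α + 1 = 2 * m + 2 * α + 1 + 1 + 1 by ring, hΓ', hΓ]
    linear_combination (2 * (m : ℝ) + 2 * α + 1 + 1) * Gamma (2 * m + 2 * α + 1) * hrec
      + (2 * (m : ℝ) + 2 * α + 1 + 1) * (2 * m + 1) * ih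
      - 2 * (2 * (m : ℝ) + 1) * (2 * m)! * Gamma (2 * α + 1) * hchoose

theorem abs_eval_zero_gegenbauer_of_even (hα : -1 / 2 < α) (hn : Even n) :
    |(gegenbauer α n).eval 0| =
      n ! * Gamma (2 * α + 1) / Gamma (n + 2 * α + 1) * Ring.choose ((n / 2 : ℕ) + α) (n / 2) := by
  have hΓ := Gamma_pos_of_pos (s := n + 2 * α + 1) (by linarith [n.cast_nonneg (α := ℝ)])
  obtain ⟨m, rfl⟩ := even_iff_exists_two_mul.1 hn
  rw [div_mul_eq_mul_div, eq_div_iff hΓ.ne', mul_comm, Nat.mul_div_cancel_left m two_pos,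
    ← Gamma_mul_abs_eval_zero_gegenbauer hα, Nat.cast_mul, Nat.cast_two]

theorem abs_eval_zero_gegenbauer_add_one_of_odd (hα : -1 / 2 < α) (hn : Odd n) :
    |(gegenbauer α (n + 1)).eval 0| =
      n ! * Gamma (2 * α + 1) / Gamma (n + 2 * α + 1) * Ring.choose ((n / 2 : ℕ) + α) (n / 2) := by
  have hΓ := Gamma_pos_of_pos (s := n + 2 * α + 1) (by linarith [n.cast_nonneg (α := ℝ)])
  obtain ⟨m, rfl⟩ := hn
  have := m.cast_nonneg (α := ℝ)
  have hrec := congrArg abs (eval_gegenbauer_add_two hα (2 * m) 0)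
  push_cast at hrec
  rw [mul_zero, zero_mul, zero_sub, abs_neg, abs_mul, abs_mul,
    abs_of_pos (a := 2 * (m : ℝ) + 1 + 2 * α) (by linarith),
    abs_of_pos (a := 2 * (m : ℝ) + 1) (by linarith)] at hrec
  have hΓ' := Gamma_add_one (s := 2 * m + 2 * α + 1) (by linarith)
  have heval := Gamma_mul_abs_eval_zero_gegenbauer hα m
  rw [div_mul_eq_mul_div, eq_div_iff hΓ.ne', show (2 * m + 1) / 2 = m by lia]
  push_cast [Nat.factorial_succ (2 * m)]
  rw [show 2 * (m : ℝ) + 1 + 2 * α + 1 = 2 * m + 2 * α + 1 + 1 by ring, hΓ']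
  linear_combination Gamma (2 * m + 2 * α + 1) * hrec + (2 * m + 1) * heval

theorem abs_eval_zero_gegenbauer_add_one_of_odd_of_ne_zero (hα : -1 / 2 < α) (hα₀ : α ≠ 0)
    (hn : Odd n) :
    |(gegenbauer α (n + 1)).eval 0| = (n + 1)! * |Gamma (2 * α)| / Gamma (n + 2 * α + 1) *
      |Ring.choose (((n : ℝ) + 1) / 2 + α - 1) ((n + 1) / 2)| := by
  rw [abs_eval_zero_gegenbauer_add_one_of_odd hα hn]
  obtain ⟨m, rfl⟩ := hn
  rw [show (2 * m + 1) / 2 = m by lia, show (2 * m + 1 + 1) / 2 = m + 1 by lia,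
    show (((2 * m + 1 : ℕ) : ℝ) + 1) / 2 + α - 1 = m + α by push_cast; ring,
    div_mul_eq_mul_div, div_mul_eq_mul_div, factorial_mul_abs_Gamma_mul_abs_ring_choose hα hα₀]

theorem errorCoeff_mul_factorial_mul_Gamma_div (hα : -1 / 2 < α) (n : ℕ) :
    errorCoeff α n * (n ! * Gamma (2 * α + 1) / Gamma (n + 2 * α + 1)) =
      Gamma (α + 1) / ((n + 1) * Gamma (n + α + 1)) := by
  have h₁ := (Gamma_pos_of_pos (s := 2 * α + 1) (by linarith)).ne'
  have h₂ := (Gamma_pos_of_pos (s := n + 2 * α + 1) (by linarith [n.cast_nonneg (α := ℝ)])).ne'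
  rw [errorCoeff, Gamma_natCast_add_two, Nat.factorial_succ, Nat.cast_mul, Nat.cast_add_one]
  generalize Gamma (2 * α + 1) = a at *
  generalize Gamma (n + 2 * α + 1) = b at *
  field_simp

theorem errorCoeff_mul_abs_eval_gegenbauer_le_of_even (hα : -1 / 2 < α) (hα₀ : α ≤ 0)
    (hn : Even n) (hx : x ∈ Icc (-1) 1) :
    errorCoeff α n * |(gegenbauer α (n + 1)).eval x| ≤
      Gamma (α + 1) / (√((n + 1) * (2 * α + n + 1)) * Gamma (n + α + 1))
        * Ring.choose ((n / 2 : ℕ) + α) (n / 2) := by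
  refine (mul_le_mul_of_nonneg_left (abs_eval_gegenbauer_add_one_le_of_even hα hα₀ hn hx)
    (errorCoeff_pos hα n).le).trans_eq ?_
  calc _
    _ = errorCoeff α n * (n ! * Gamma (2 * α + 1) / Gamma (n + 2 * α + 1)) * (n + 1)
          / √((n + 1) * (2 * α + n + 1)) * Ring.choose ((n / 2 : ℕ) + α) (n / 2) := by
      rw [abs_eval_zero_gegenbauer_of_even hα hn]
      ring
    _ = _ := by
      rw [errorCoeff_mul_factorial_mul_Gamma_div hα]
      field_simp

theorem errorCoeff_mul_abs_eval_gegenbauer_le_of_odd (hα : -1 / 2 < α) (hα₀ : α ≤ 0)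
    (hn : Odd n) (hx : x ∈ Icc (-1) 1) :
    errorCoeff α n * |(gegenbauer α (n + 1)).eval x| ≤
      Gamma (α + 1) / ((n + 1) * Gamma (n + α + 1)) * Ring.choose ((n / 2 : ℕ) + α) (n / 2) := by
  refine (mul_le_mul_of_nonneg_left (abs_eval_gegenbauer_add_one_le_of_odd hα hα₀ hn hx)
    (errorCoeff_pos hα n).le).trans_eq ?_
  rw [abs_eval_zero_gegenbauer_add_one_of_odd hα hn, ← mul_assoc,
    errorCoeff_mul_factorial_mul_Gamma_div hα]

theorem errorCoeff_mul_abs_eval_gegenbauer_le (hα : -1 / 2 < α) (hα₀ : α ≤ 0) (n : ℕ)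
    (hx : x ∈ Icc (-1) 1) :
    errorCoeff α n * |(gegenbauer α (n + 1)).eval x| ≤
      Gamma (α + 1) / (√(1 + 2 * α) * (n + 1) * Gamma (n + α + 1))
        * Ring.choose ((n / 2 : ℕ) + α) (n / 2) := by
  have hn := n.cast_nonneg (α := ℝ)
  have hsqrt : 0 < √(1 + 2 * α) := sqrt_pos.2 (by linarith)
  have hΓ := Gamma_pos_of_pos (s := α + 1) (by linarith)
  have hΓ' := Gamma_pos_of_pos (s := n + α + 1) (by linarith)
  have hchoose := ring_choose_natCast_add_pos (β := α) (by linarith) (n / 2)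
  rcases n.even_or_odd with heven | hodd
  · refine (errorCoeff_mul_abs_eval_gegenbauer_le_of_even hα hα₀ heven hx).trans ?_
    have hle : √(1 + 2 * α) * (n + 1) ≤ √((n + 1) * (2 * α + n + 1)) := by
      refine le_sqrt_of_sq_le ?_
      rw [mul_pow, sq_sqrt (by linarith)]
      nlinarith [mul_nonneg (mul_nonneg hn (by linarith : 0 ≤ (n : ℝ) + 1)) (neg_nonneg.2 hα₀)]
    gcongr
  · refine (errorCoeff_mul_abs_eval_gegenbauer_le_of_odd hα hα₀ hodd hx).trans ?_
    have hle : √(1 + 2 * α) * (n + 1) ≤ n + 1 :=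
      mul_le_of_le_one_left (by linarith) (sqrt_le_one.2 (by linarith))
    gcongr

end ErrorCoefficient

section Asymptotics

variable {s t : ℝ}

theorem Gamma_mul_prod_range_add (hs : 0 < s) (m : ℕ) :
    Gamma s * ∏ j ∈ Finset.range m, (s + j) = Gamma (s + m) := by
  induction m with
  | zero => simp
  | succ m ih =>
    rw [Finset.prod_range_succ, ← mul_assoc, ih, mul_comm, ← Gamma_add_one (by positivity)]
    push_cast
    ring_nf

theorem tendsto_rpow_mul_factorial_div_Gamma (hs : -1 < s) :
    Tendsto (fun n : ℕ => ((n : ℝ) + 1) ^ s * n ! / Gamma (n + s + 1)) atTop (𝓝 1) := by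
  have hs' : 0 < s + 1 := by linarith
  have hΓ := Gamma_pos_of_pos hs'
  have hratio (c : ℝ) : Tendsto (fun n : ℕ => 1 + c * (1 / ((n : ℝ) + 1))) atTop (𝓝 1) := by
    simpa using (tendsto_one_div_add_atTop_nhds_zero_nat.const_mul c).const_add 1
  have hlim := ((((tendsto_add_atTop_iff_nat 1).2 (GammaSeq_tendsto_Gamma (s + 1))).div_const
    (Gamma (s + 1))).mul ((hratio s).mul (hratio (s + 1))))
  rw [div_self hΓ.ne', mul_one, mul_one] at hlim
  refine hlim.congr fun n => ?_
  have := n.cast_nonneg (α := ℝ)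
  have hΓn := Gamma_pos_of_pos (s := n + s + 1) (by linarith)
  have hΓadd := Gamma_add_one (s := n + s + 1) (by linarith)
  have hΓadd' := Gamma_add_one (s := n + s + 1 + 1) (by linarith)
  have h₁ : (n : ℝ) + s + 1 ≠ 0 := by linarith
  have h₂ : (n : ℝ) + s + 1 + 1 ≠ 0 := by linarith
  have hprod := Gamma_mul_prod_range_add hs' (n + 1 + 1)
  push_cast at hprod
  rw [GammaSeq, div_div, mul_comm _ (Gamma (s + 1)), hprod,
    show s + 1 + ((n : ℝ) + 1 + 1) = n + s + 1 + 1 + 1 by ring, hΓadd', hΓadd,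
    Nat.cast_add_one, rpow_add_one (by positivity), Nat.factorial_succ, Nat.cast_mul,
    Nat.cast_add_one]
  field_simp
  ring

theorem exists_forall_Gamma_div_Gamma_le (hs : -1 < s) (ht : -1 < t) :
    ∃ K > 0, ∀ n : ℕ, Gamma (n + s + 1) / Gamma (n + t + 1) ≤ K * ((n : ℝ) + 1) ^ (s - t) := by
  have hlim := (tendsto_rpow_mul_factorial_div_Gamma ht).div
    (tendsto_rpow_mul_factorial_div_Gamma hs) one_ne_zero
  obtain ⟨K, hK⟩ := hlim.bddAbove_range
  refine ⟨max K 1, by positivity, fun n => ?_⟩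
  have := n.cast_nonneg (α := ℝ)
  have hΓs := Gamma_pos_of_pos (s := n + s + 1) (by linarith)
  have hΓt := Gamma_pos_of_pos (s := n + t + 1) (by linarith)
  calc Gamma (n + s + 1) / Gamma (n + t + 1)
    _ = ((n : ℝ) + 1) ^ t * n ! / Gamma (n + t + 1) / (((n : ℝ) + 1) ^ s * n ! / Gamma (n + s + 1))
          * ((n : ℝ) + 1) ^ (s - t) := by
      rw [rpow_sub (by positivity)]
      field_simp
    _ ≤ max K 1 * ((n : ℝ) + 1) ^ (s - t) := by
      gcongr
      exact (hK ⟨n, rfl⟩).trans (le_max_left _ _)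

variable {α : ℝ}

theorem exists_errorCoeff_le (hα : -1 / 2 < α) :
    ∃ K > 0, ∀ n : ℕ, errorCoeff α n ≤ K * (((n : ℝ) + 1) ^ α / (n + 1)!) := by
  have hΓ := Gamma_pos_of_pos (s := α + 1) (by linarith)
  have hΓ' := Gamma_pos_of_pos (s := 2 * α + 1) (by linarith)
  obtain ⟨K, hK, hle⟩ := exists_forall_Gamma_div_Gamma_le (s := 2 * α) (t := α)
    (by linarith) (by linarith)
  refine ⟨Gamma (α + 1) / Gamma (2 * α + 1) * K, by positivity, fun n => ?_⟩
  calc errorCoeff α n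
    _ = Gamma (α + 1) / Gamma (2 * α + 1) * (Gamma (n + 2 * α + 1) / Gamma (n + α + 1))
          / (n + 1)! := by
      rw [errorCoeff, Gamma_natCast_add_two]
      ring
    _ ≤ Gamma (α + 1) / Gamma (2 * α + 1) * (K * ((n : ℝ) + 1) ^ (2 * α - α)) / (n + 1)! := by
      gcongr
      exact hle n
    _ = _ := by
      rw [show 2 * α - α = α by ring]
      ring

theorem div_two_add_one_rpow_le (hα : α ≤ 0) (n : ℕ) :
    ((n / 2 : ℕ) + 1 : ℝ) ^ α ≤ 2⁻¹ ^ α * ((n : ℝ) + 1) ^ α := by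
  have hle : (n : ℝ) + 1 ≤ 2 * ((n / 2 : ℕ) + 1) := by
    exact_mod_cast (by lia : n + 1 ≤ 2 * (n / 2 + 1))
  rw [← mul_rpow (by norm_num) (by positivity)]
  exact rpow_le_rpow_of_nonpos (by positivity) (by linarith) hα

theorem exists_ring_choose_div_Gamma_le (hα : -1 < α) (hα₀ : α ≤ 0) :
    ∃ K > 0, ∀ n : ℕ,
      Gamma (α + 1) / Gamma (n + α + 1) * Ring.choose ((n / 2 : ℕ) + α) (n / 2) ≤ K / n ! := by
  have hΓ := Gamma_pos_of_pos (s := α + 1) (by linarith)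
  obtain ⟨K, hK, hle⟩ := exists_forall_Gamma_div_Gamma_le (s := α) (t := 0) hα (by norm_num)
  obtain ⟨K', hK', hle'⟩ := exists_forall_Gamma_div_Gamma_le (s := 0) (t := α) (by norm_num) hα
  simp only [add_zero, sub_zero, zero_sub, Gamma_nat_eq_factorial] at hle hle'
  refine ⟨K * 2⁻¹ ^ α * K', by positivity, fun n => ?_⟩
  have hΓn := Gamma_pos_of_pos (s := n + α + 1) (by linarith [n.cast_nonneg (α := ℝ)])
  calc _
    _ = Gamma ((n / 2 : ℕ) + α + 1) / (n / 2)! * (n ! / Gamma (n + α + 1)) / n ! := by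
      rw [ring_choose_natCast_add hα]
      field_simp
    _ ≤ K * (2⁻¹ ^ α * ((n : ℝ) + 1) ^ α) * (K' * ((n : ℝ) + 1) ^ (-α)) / n ! := by
      gcongr
      · exact (hle _).trans (by gcongr; exact div_two_add_one_rpow_le hα₀ n)
      · exact hle' n
    _ = K * 2⁻¹ ^ α * K' / n ! := by
      rw [rpow_neg (by positivity)]
      field_simp

theorem exists_errorCoeff_mul_abs_eval_gegenbauer_le (hα : -1 / 2 < α) :
    ∃ K > 0, ∀ n : ℕ, ∀ x ∈ Icc (-1 : ℝ) 1, errorCoeff α n * |(gegenbauer α (n + 1)).eval x| ≤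
      K * (((n : ℝ) + 1) ^ max α 0 / (n + 1)!) := by
  rcases le_or_gt 0 α with h | h
  · obtain ⟨K, hK, hle⟩ := exists_errorCoeff_le hα
    refine ⟨K, hK, fun n x hx => ?_⟩
    rw [max_eq_left h]
    exact (mul_le_of_le_one_right (errorCoeff_pos hα n).le
      (abs_eval_gegenbauer_le_one h (n + 1) hx)).trans (hle n)
  · have hsqrt : 0 < √(1 + 2 * α) := sqrt_pos.2 (by linarith)
    obtain ⟨K, hK, hle⟩ := exists_ring_choose_div_Gamma_le (by linarith) h.le
    refine ⟨K / √(1 + 2 * α), by positivity, fun n x hx => ?_⟩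
    calc _
      _ ≤ _ := errorCoeff_mul_abs_eval_gegenbauer_le hα h.le n hx
      _ = Gamma (α + 1) / Gamma (n + α + 1) * Ring.choose ((n / 2 : ℕ) + α) (n / 2)
            / (√(1 + 2 * α) * (n + 1)) := by
        rw [div_mul_eq_mul_div, div_mul_eq_mul_div, div_div, mul_comm (Gamma (n + α + 1))]
      _ ≤ K / n ! / (√(1 + 2 * α) * (n + 1)) := by
        gcongr
        exact hle n
      _ = _ := by
        rw [max_eq_right h.le, rpow_zero, Nat.factorial_succ, Nat.cast_mul, Nat.cast_add_one]
        field_simp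

theorem rpow_add_half_le_exp_mul_factorial {n : ℕ} (hn : n ≠ 0) :
    (n : ℝ) ^ ((n : ℝ) + 1 / 2) ≤ exp n * n ! := by
  have hn' : 0 < (n : ℝ) := by positivity
  have hle : (n : ℝ) ≤ 2 * π * n := by nlinarith [pi_gt_three]
  calc (n : ℝ) ^ ((n : ℝ) + 1 / 2)
    _ = exp n * (√n * (n / exp 1) ^ n) := by
      rw [rpow_add hn', rpow_natCast, ← sqrt_eq_rpow, div_pow, ← exp_nat_mul, mul_one]
      field_simp
    _ ≤ exp n * (√(2 * π * n) * (n / exp 1) ^ n) := by gcongr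
    _ ≤ exp n * n ! := by
      gcongr
      exact Stirling.le_factorial_stirling n

theorem add_one_rpow_div_factorial_le {n : ℕ} (hn : n ≠ 0) {a : ℝ} (ha : 0 ≤ a) :
    ((n : ℝ) + 1) ^ a / (n + 1)! ≤ 2 ^ a * (exp n / (n : ℝ) ^ ((n : ℝ) + 3 / 2 - a)) := by
  have hn' : 1 ≤ (n : ℝ) := Nat.one_le_cast.2 (Nat.one_le_iff_ne_zero.2 hn)
  have hstirling := rpow_add_half_le_exp_mul_factorial hn
  calc ((n : ℝ) + 1) ^ a / (n + 1)!
    _ ≤ (2 * n) ^ a / (n * n !) := by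
      rw [Nat.factorial_succ]
      push_cast
      gcongr <;> linarith
    _ = 2 ^ a * ((n : ℝ) ^ ((n : ℝ) + 1 / 2) / n ! / (n : ℝ) ^ ((n : ℝ) + 3 / 2 - a)) := by
      rw [mul_rpow two_pos.le (by positivity),
        show (n : ℝ) + 3 / 2 - a = n + 1 / 2 + 1 - a by ring, rpow_sub (by positivity),
        rpow_add_one (by positivity)]
      field_simp
    _ ≤ 2 ^ a * (exp n / (n : ℝ) ^ ((n : ℝ) + 3 / 2 - a)) := by
      gcongr
      rwa [div_le_iff₀ (by positivity)]

theorem pow_mul_rpow_div_factorial_le_exp {l a : ℝ} (hl : 0 ≤ l) (ha : 0 ≤ a) (n : ℕ) :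
    l ^ n * ((n : ℝ) ^ a / n !) ≤ exp (l * exp a) := by
  have hpow : (n : ℝ) ^ a ≤ exp a ^ n := by
    calc (n : ℝ) ^ a ≤ exp n ^ a := by gcongr; linarith [add_one_le_exp (n : ℝ)]
      _ = exp a ^ n := by rw [← exp_mul, ← exp_nat_mul]
  calc l ^ n * ((n : ℝ) ^ a / n !)
    _ ≤ l ^ n * (exp a ^ n / n !) := by gcongr
    _ = (l * exp a) ^ n / n ! := by ring
    _ ≤ exp (l * exp a) := pow_div_factorial_le_exp _ (by positivity) n

end Asymptotics

section ErrorBounds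

variable {l α A : ℝ} {n : ℕ} {f : ℝ → ℝ}

theorem two_zpow_neg_two_mul_sub_one (n : ℕ) :
    (2 : ℝ) ^ (-2 * (n : ℤ) - 1) = (2 ^ (2 * n + 1))⁻¹ := by
  rw [← zpow_natCast, ← zpow_neg]
  push_cast
  ring_nf

theorem abs_bsgqError_lt_of_abs_eval_gegenbauer_le (hα : -1 / 2 < α) (hl : 0 < l) (hA : 0 < A)
    (hf : DerivBound l n f A) (i : Fin (n + 1)) {M : ℝ}
    (hM : ∀ x ∈ Icc (-1 : ℝ) 1, |(gegenbauer α (n + 1)).eval x| ≤ M) :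
    |bsgqError l α n f i| <
      A * 2 ^ (-2 * (n : ℤ) - 1) * Gamma (α + 1) * sggNode l α n i * l ^ (n + 1)
          * Gamma (n + 2 * α + 1)
        / (Gamma (2 * α + 1) * Gamma (n + 2) * Gamma (n + α + 1)) * M := by
  refine (abs_bsgqError_lt hα hl hA hf i fun x hx =>
    mul_le_mul_of_nonneg_left (hM x hx) (errorCoeff_pos hα n).le).trans_eq ?_
  rw [two_zpow_neg_two_mul_sub_one, errorCoeff]
  ring

theorem abs_bsgqError_lt_of_even (hα : -1 / 2 < α) (hα₀ : α < 0) (hn : Even n) (hl : 0 < l)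
    (hA : 0 < A) (hf : DerivBound l n f A) (i : Fin (n + 1)) :
    |bsgqError l α n f i| <
      A * 2 ^ (-2 * (n : ℤ) - 1) * |Gamma α| * |α| * sggNode l α n i * l ^ (n + 1)
        / (√(((n : ℝ) + 1) * (2 * α + n + 1)) * Gamma (n + α + 1))
        * |Ring.choose ((n : ℝ) / 2 + α) (n / 2)| := by
  have hΓ : |Gamma α| * |α| = Gamma (α + 1) := by
    rw [← abs_mul, mul_comm, ← Gamma_add_one hα₀.ne, abs_of_pos (Gamma_pos_of_pos (by linarith))]
  have hhalf : (n : ℝ) / 2 = (n / 2 : ℕ) :=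
    (Nat.cast_div hn.two_dvd two_ne_zero).symm
  refine (abs_bsgqError_lt hα hl hA hf i fun x hx =>
    errorCoeff_mul_abs_eval_gegenbauer_le_of_even hα hα₀.le hn hx).trans_eq ?_
  rw [hhalf, abs_of_pos (ring_choose_natCast_add_pos (by linarith) (n / 2)),
    two_zpow_neg_two_mul_sub_one, ← hΓ]
  ring

theorem exists_abs_bsgqError_le (hα : -1 / 2 < α) :
    ∃ K > 0, ∀ (l : ℝ) (n : ℕ) (f : ℝ → ℝ) (A : ℝ), 0 < l → 0 < A → DerivBound l n f A →
      ∀ i : Fin (n + 1), |bsgqError l α n f i| ≤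
        A * l ^ (n + 1) * sggNode l α n i / 2 ^ (2 * n + 1)
          * (K * (((n : ℝ) + 1) ^ max α 0 / (n + 1)!)) := by
  obtain ⟨K, hK, hle⟩ := exists_errorCoeff_mul_abs_eval_gegenbauer_le hα
  exact ⟨K, hK, fun l n f A hl hA hf i => (abs_bsgqError_lt hα hl hA hf i (hle n)).le⟩

theorem exists_abs_bsgqError_le_exp_div_rpow (hα : -1 / 2 < α) :
    ∃ D > 0, ∀ (l : ℝ) (n : ℕ) (f : ℝ → ℝ) (A : ℝ), n ≠ 0 → 0 < l → 0 < A → DerivBound l n f A →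
      ∀ i : Fin (n + 1), |bsgqError l α n f i| ≤
        A * D * (exp n * l ^ (n + 1) * sggNode l α n i
          / (2 ^ (2 * n + 1) * (n : ℝ) ^ ((n : ℝ) + 3 / 2 - max α 0))) := by
  obtain ⟨K, hK, hle⟩ := exists_abs_bsgqError_le hα
  refine ⟨K * 2 ^ max α 0, by positivity, fun l n f A hn hl hA hf i => ?_⟩
  have hnode := (sggNode_mem_Ioo hα hl n i).1
  calc |bsgqError l α n f i|
    _ ≤ A * l ^ (n + 1) * sggNode l α n i / 2 ^ (2 * n + 1)
          * (K * (((n : ℝ) + 1) ^ max α 0 / (n + 1)!)) := hle l n f A hl hA hf i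
    _ ≤ A * l ^ (n + 1) * sggNode l α n i / 2 ^ (2 * n + 1)
          * (K * (2 ^ max α 0 * (exp n / (n : ℝ) ^ ((n : ℝ) + 3 / 2 - max α 0)))) := by
      gcongr
      exact add_one_rpow_div_factorial_le hn (le_max_right α 0)
    _ = _ := by ring

theorem exists_abs_bsgqError_le_geometric (hα : -1 / 2 < α) (hl : 0 < l) :
    ∃ c > 0, ∀ (n : ℕ) (f : ℝ → ℝ) (A : ℝ), 0 < A → DerivBound l n f A →
      ∀ i : Fin (n + 1), |bsgqError l α n f i| ≤ A * c * (1 / 4) ^ n := by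
  obtain ⟨K, hK, hle⟩ := exists_abs_bsgqError_le hα
  refine ⟨K * l * exp (l * exp (max α 0)) / 2, by positivity, fun n f A hA hf i => ?_⟩
  have hnode := sggNode_mem_Ioo hα hl n i
  have hexp := pow_mul_rpow_div_factorial_le_exp hl.le (le_max_right α 0) (n + 1)
  push_cast at hexp
  calc |bsgqError l α n f i|
    _ ≤ A * l ^ (n + 1) * sggNode l α n i / 2 ^ (2 * n + 1)
          * (K * (((n : ℝ) + 1) ^ max α 0 / (n + 1)!)) := hle l n f A hl hA hf i
    _ = A * K * sggNode l α n i * (l ^ (n + 1) * (((n : ℝ) + 1) ^ max α 0 / (n + 1)!))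
          / 2 ^ (2 * n + 1) := by ring
    _ ≤ A * K * l * exp (l * exp (max α 0)) / 2 ^ (2 * n + 1) := by
      gcongr
      exact hnode.2.le
    _ = A * (K * l * exp (l * exp (max α 0)) / 2) * (1 / 4) ^ n := by
      rw [pow_succ, pow_mul, one_div_pow]
      ring

end ErrorBounds

theorem mainTheorem2 (α : ℝ) (hα : -1 / 2 < α) :
    (∀ l : ℝ, 0 < l → ∀ (n : ℕ) (f : ℝ → ℝ) (A : ℝ), 0 < A → DerivBound l n f A →
      ∀ i : Fin (n + 1),
        (0 ≤ α →
          |bsgqError l α n f i| ≤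
            A * (2 : ℝ) ^ (-2 * (n : ℤ) - 1) * Real.Gamma (α + 1) * sggNode l α n i * l ^ (n + 1)
                * Real.Gamma (n + 2 * α + 1)
              / (Real.Gamma (2 * α + 1) * Real.Gamma (n + 2) * Real.Gamma (n + α + 1))) ∧
        (Odd n → α < 0 →
          |bsgqError l α n f i| ≤
            A * (2 : ℝ) ^ (-2 * (n : ℤ) - 1) * Real.Gamma (α + 1) * sggNode l α n i * l ^ (n + 1)
                * Real.Gamma (n + 2 * α + 1)
              / (Real.Gamma (2 * α + 1) * Real.Gamma (n + 2) * Real.Gamma (n + α + 1))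
              * (((n + 1).factorial : ℝ) * |Real.Gamma (2 * α)| / Real.Gamma (n + 2 * α + 1)
                * |Ring.choose (((n : ℝ) + 1) / 2 + α - 1) ((n + 1) / 2)|)) ∧
        (Even n → α < 0 →
          |bsgqError l α n f i| <
            A * (2 : ℝ) ^ (-2 * (n : ℤ) - 1) * |Real.Gamma α| * |α| * sggNode l α n i * l ^ (n + 1)
              / (Real.sqrt (((n : ℝ) + 1) * (2 * α + n + 1)) * Real.Gamma (n + α + 1))
              * |Ring.choose ((n : ℝ) / 2 + α) (n / 2)|)) ∧
    (∃ D₁ D₂ : ℝ, 0 < D₁ ∧ 0 < D₂ ∧ ∃ N : ℕ,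
      ∀ n : ℕ, N ≤ n → ∀ l : ℝ, 0 < l → ∀ (f : ℝ → ℝ) (A : ℝ), 0 < A → DerivBound l n f A →
        ∀ i : Fin (n + 1),
          (0 ≤ α →
            |bsgqError l α n f i| ≤
              A * D₁ * (Real.exp n * l ^ (n + 1) * sggNode l α n i
                / ((2 : ℝ) ^ (2 * n + 1) * (n : ℝ) ^ ((n : ℝ) + 3 / 2 - α)))) ∧
          (α < 0 →
            |bsgqError l α n f i| ≤
              A * D₁ * D₂ * (Real.exp n * l ^ (n + 1) * sggNode l α n i
                / ((2 : ℝ) ^ (2 * n + 1) * (n : ℝ) ^ ((n : ℝ) + 3 / 2))))) ∧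
    (∀ l : ℝ, 0 < l → ∃ c ρ : ℝ, 0 < c ∧ 0 < ρ ∧ ρ < 1 ∧
      ∀ (n : ℕ) (f : ℝ → ℝ) (A : ℝ), 0 < A → DerivBound l n f A → ∀ i : Fin (n + 1),
        |bsgqError l α n f i| ≤ A * c * ρ ^ n) := by
  refine ⟨fun l hl n f A hA hf i => ⟨fun h => ?_, fun hn h => ?_, fun hn h => ?_⟩, ?_,
    fun l hl => ?_⟩
  · have hE := abs_bsgqError_lt_of_abs_eval_gegenbauer_le hα hl hA hf i
      fun x hx => abs_eval_gegenbauer_le_one h (n + 1) hx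
    rw [mul_one] at hE
    exact hE.le
  · rw [← abs_eval_zero_gegenbauer_add_one_of_odd_of_ne_zero hα h.ne hn]
    exact (abs_bsgqError_lt_of_abs_eval_gegenbauer_le hα hl hA hf i
      fun x hx => abs_eval_gegenbauer_add_one_le_of_odd hα h.le hn hx).le
  · exact abs_bsgqError_lt_of_even hα h hn hl hA hf i
  · obtain ⟨D, hD, hE⟩ := exists_abs_bsgqError_le_exp_div_rpow hα
    refine ⟨D, 1, hD, one_pos, 1, fun n hn l hl f A hA hf i => ⟨fun h => ?_, fun h => ?_⟩⟩
    · have hE' := hE l n f A (Nat.one_le_iff_ne_zero.1 hn) hl hA hf i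
      rwa [max_eq_left h] at hE'
    · have hE' := hE l n f A (Nat.one_le_iff_ne_zero.1 hn) hl hA hf i
      rwa [max_eq_right h.le, sub_zero, ← mul_one (A * D)] at hE'
  · obtain ⟨c, hc, hE⟩ := exists_abs_bsgqError_le_geometric hα hl
    exact ⟨c, 1 / 4, hc, by norm_num, by norm_num, hE⟩
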